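/- Let $\mathcal H$ be a complex Hilbert space with scalar product $\langle\cdot,\cdot\rangle$ and let $\mathcal D\subset\mathcal H$ be a dense linear manifold with $\dim\mathcal D\neq 1$. Let $\mathcal L^+(\mathcal D)$ be the $*$-algebra of all linear operators $A:\mathcal D\to\mathcal D$ such that the adjoint $A^*$ is defined on $\mathcal D$ and $A^*\mathcal D\subset\mathcal D$, with involution $A^+=A^*|_{\mathcal D}$, and let $\mathcal F(\mathcal D)$ be the set of all finite rank operators in $\mathcal L^+(\mathcal D)$. Suppose that $\mathcal D$ is an (F)-domain, i.e. that $\mathcal D$ with the graph topology generated by the seminorms $\varphi\mapsto\|A\varphi\|$, $A\in\mathcal L^+(\mathcal D)$, is an (F)-space (a complete metrizable topological vector space). **Theorem 3.1.** Let $\mathcal A\subset\mathcal L^+(\mathcal D)$ be one of the following: a) $\mathcal A=\mathcal F(\mathcal D)$; b) $\mathcal A$ is a unital standard $*$-operator algebra, i.e. a $*$-subalgebra of $\mathcal L^+(\mathcal D)$ with $\mathcal F(\mathcal D)\subset\mathcal A$ and $I\in\mathcal A$; c) $\mathcal A$ is a two-sided $*$-ideal of $\mathcal L^+(\mathcal D)$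 with $\mathcal A\neq\mathcal F(\mathcal D)$. Let $\Phi:\mathcal A\to\mathcal A$ be an additive bijection that preserves orthogonality in both directions, i.e. for all $S,T\in\mathcal A$, $$S^+T=ST^+=0\iff \Phi(S)^+\Phi(T)=\Phi(S)\Phi(T)^+=0 .$$ Then there are a constant $c\in\mathbb C$, $c\neq0$, and maps $U,V:\mathcal D\to\mathcal D$, either both unitary (linear isometric bijections of $\mathcal D$) or both antiunitary (conjugate linear isometric bijections of $\mathcal D$), such that either $\Phi(T)=c\,UTV$ for all $T\in\mathcal A$, or $\Phi(T)=c\,UT^+V$ for all $T\in\mathcal A$. -/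

import Mathlib

noncomputable section

namespace UnboundedOp

variable {H : Type*} [NormedAddCommGroup H] [InnerProductSpace ℂ H]

/-- The algebra `L⁺(D)` of a linear manifold `D` of a Hilbert space: all linear operators
`A : D → D` such that the adjoint `A*` is defined on `D` and maps `D` into `D`, that is, such
that some linear `B : D → D` satisfies `⟪A x, y⟫ = ⟪x, B y⟫` on `D` (then `B = A*|D`; see
`mem_LPlus_iff_adjoint`). -/
def LPlus (D : Submodule ℂ H) : Subalgebra ℂ (Module.End ℂ D) where
  carrier := {A | ∃ B : Module.End ℂ D, ∀ x y : D, inner ℂ (A x) y = inner ℂ x (B y)}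
  mul_mem' := by
    rintro A A' ⟨B, hB⟩ ⟨B', hB'⟩
    exact ⟨B' * B, fun x y => by rw [Module.End.mul_apply, hB, hB', Module.End.mul_apply]⟩
  add_mem' := by
    rintro A A' ⟨B, hB⟩ ⟨B', hB'⟩
    exact ⟨B + B', fun x y => by
      rw [LinearMap.add_apply, LinearMap.add_apply, inner_add_left, inner_add_right, hB, hB']⟩
  algebraMap_mem' := by
    intro r
    exact ⟨algebraMap ℂ _ (starRingEnd ℂ r), fun x y => by
      rw [Module.algebraMap_end_apply, Module.algebraMap_end_apply, inner_smul_left,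
        inner_smul_right]⟩

/-- The densely defined operator in `H` with domain `D` given by `A : D → D`. -/
def toPMap {D : Submodule ℂ H} (A : Module.End ℂ D) : H →ₗ.[ℂ] H :=
  ⟨D, D.subtype ∘ₗ A⟩

/-- For dense `D`, membership in `L⁺(D)` means exactly that the Hilbert space adjoint is
defined on all of `D` and maps `D` into `D`. -/
theorem mem_LPlus_iff_adjoint [CompleteSpace H] {D : Submodule ℂ H} (hD : Dense (D : Set H))
    (A : Module.End ℂ D) :
    A ∈ LPlus D ↔
      ∀ y ∈ D, ∃ hy : y ∈ (toPMap A).adjoint.domain, (toPMap A).adjoint ⟨y, hy⟩ ∈ D := by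
  have hd : Dense ((toPMap A).domain : Set H) := hD
  constructor
  · rintro ⟨B, hB⟩ y hy
    have key' : ∀ x : D, inner ℂ (B ⟨y, hy⟩) x = inner ℂ (⟨y, hy⟩ : D) (A x) := by
      intro x
      rw [← inner_conj_symm, ← hB, inner_conj_symm]
    have key : ∀ x : (toPMap A).domain,
        inner ℂ ((B ⟨y, hy⟩ : D) : H) (x : H) = inner ℂ y (toPMap A x) := key'
    have hmem : y ∈ (toPMap A).adjoint.domain :=
      LinearPMap.mem_adjoint_domain_of_exists y ⟨_, key⟩
    refine ⟨hmem, ?_⟩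
    rw [LinearPMap.adjoint_apply_eq hd (y := ⟨y, hmem⟩) key]
    exact (B ⟨y, hy⟩).2
  · intro h
    let B : Module.End ℂ D :=
      { toFun := fun y => ⟨(toPMap A).adjoint ⟨y, (h y y.2).1⟩, (h y y.2).2⟩
        map_add' := fun y z => Subtype.ext
          ((toPMap A).adjoint.map_add ⟨y, (h y y.2).1⟩ ⟨z, (h z z.2).1⟩)
        map_smul' := fun c y => Subtype.ext
          ((toPMap A).adjoint.map_smul c ⟨y, (h y y.2).1⟩) }
    refine ⟨B, fun x y => ?_⟩
    have h1 := LinearPMap.adjoint_isFormalAdjoint hd ⟨y, (h y y.2).1⟩ x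
    have h2 := congrArg (starRingEnd ℂ) h1
    rw [inner_conj_symm, inner_conj_symm] at h2
    exact h2.symm

variable {D : Submodule ℂ H}

/-- The involution `A ↦ A⁺ = A*|D` of `L⁺(D)`. -/
instance : Star (LPlus D) where
  star A := ⟨A.2.choose, A.1, fun x y => by
    rw [← inner_conj_symm, ← A.2.choose_spec, inner_conj_symm]⟩

theorem inner_apply_left (A : LPlus D) (x y : D) :
    inner ℂ (A.1 x) y = inner ℂ x ((star A).1 y) :=
  A.2.choose_spec x y

theorem star_unique {A B : LPlus D} (h : ∀ x y : D, inner ℂ (A.1 x) y = inner ℂ x (B.1 y)) :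
    star A = B := by
  refine Subtype.ext (LinearMap.ext fun y => ext_inner_left ℂ fun x => ?_)
  rw [← inner_apply_left, h]

/-- `L⁺(D)` is a *-ring. -/
instance : StarRing (LPlus D) where
  star_involutive A := star_unique fun x y => by
    rw [← inner_conj_symm, ← inner_apply_left, inner_conj_symm]
  star_mul A B := star_unique fun x y => by
    change inner ℂ (A.1 (B.1 x)) y = inner ℂ x ((star B).1 ((star A).1 y))
    rw [inner_apply_left, inner_apply_left]
  star_add A B := star_unique fun x y => by
    change inner ℂ (A.1 x + B.1 x) y = inner ℂ x ((star A).1 y + (star B).1 y)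
    rw [inner_add_left, inner_add_right, inner_apply_left, inner_apply_left]

/-- The involution of `L⁺(D)` is conjugate linear. -/
instance : StarModule ℂ (LPlus D) where
  star_smul c A := star_unique fun x y => by
    change inner ℂ (c • A.1 x) y = inner ℂ x (star c • (star A).1 y)
    rw [inner_smul_left, inner_smul_right, inner_apply_left]
    rfl

/-- The seminorm `φ ↦ ‖A φ‖` on `D`. -/
def graphSeminorm (A : LPlus D) : Seminorm ℂ D :=
  (normSeminorm ℂ D).comp A.1

variable (D) in
/-- The uniform structure of the graph topology on `D`, generated by the seminorms
`φ ↦ ‖A φ‖`, `A ∈ L⁺(D)`. It is the canonical uniform structure of `D` as a topological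
vector space with the graph topology. -/
@[reducible]
def graphUniformSpace : UniformSpace D :=
  ⨅ A : LPlus D, (graphSeminorm A).toSeminormedAddCommGroup.toUniformSpace

variable (D) in
/-- `D` is an (F)-domain: with the graph topology it is an (F)-space, that is, a metrizable and
complete topological vector space. -/
def IsFDomain : Prop :=
  @TopologicalSpace.MetrizableSpace D (graphUniformSpace D).toTopologicalSpace ∧
    @CompleteSpace D (graphUniformSpace D)

variable (D) in
/-- The set `F(D)` of all finite rank operators in `L⁺(D)`. -/
def finiteRank : Set (LPlus D) :=
  {T | FiniteDimensional ℂ (LinearMap.range T.1)}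

/-- A standard *-operator algebra: a *-subalgebra of `L⁺(D)` (not necessarily unital) that
contains all finite rank operators of `L⁺(D)`. -/
def IsStandard (A : NonUnitalStarSubalgebra ℂ (LPlus D)) : Prop :=
  finiteRank D ⊆ (A : Set (LPlus D))

/-- A *-ideal of `L⁺(D)`: a *-subalgebra that absorbs multiplication by elements of `L⁺(D)`
from both sides. -/
def IsStarIdeal (A : NonUnitalStarSubalgebra ℂ (LPlus D)) : Prop :=
  ∀ X : LPlus D, ∀ T ∈ A, X * T ∈ A ∧ T * X ∈ A

/-- `S` and `T` are orthogonal: `S⁺ T = 0` and `S T⁺ = 0`. -/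
def Orthogonal (S T : LPlus D) : Prop :=
  star S * T = 0 ∧ S * star T = 0

/-- `U : D → D` is unitary: a linear isometric bijection of `D`. -/
def IsUnitaryOn (U : D → D) : Prop :=
  ∃ W : D ≃ₗᵢ[ℂ] D, ∀ x, U x = W x

/-- `U : D → D` is antiunitary: a conjugate linear isometric bijection of `D`. -/
def IsAntiunitaryOn (U : D → D) : Prop :=
  ∃ W : D ≃ₗᵢ⋆[ℂ] D, ∀ x, U x = W x

end UnboundedOp

end

/-!
The idea is to recover rank one operators `rankOne x y : z ↦ ⟪y, z⟫ x` from orthogonality, to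
determine `Φ` on them, and to extend the result to all of `A` by orthogonality once more.

* Say that `S` is dominated by `T` if everything orthogonal to `T` is orthogonal to `S`. Among the
  nonzero operators the rank one operators are the minimal ones, and the operators dominated by a
  rank one operator are its scalar multiples (`exists_smul_of_dominated`,
  `exists_dominated_mkRankOne`). Hence `Φ` permutes the complex lines spanned by rank one
  operators (`PreservesOrthogonality.exists_map_mkRankOne`). All algebras in question contain all
  rank one operators, except for the zero ideal, for which there is nothing to prove.
* A sum of two rank one operators has rank at most one only if they have the same range or their
  adjoints do. By additivity, `Φ` therefore respects the relation "`x` is the same line or `y` is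
  the same line" on pairs of lines, and, orthogonality excluding the mixed cases, it acts on each
  factor separately, possibly after composition with the involution
  (`PreservesOrthogonality.isSplit_or_isSplit`).
* In the split case `Φ (rankOne x y) = rankOne (f x) (g y)` with additive maps `f`, `g` that
  preserve orthogonality and lines (`IsSplit.exists_factors`). Such a map is semilinear over a ring
  endomorphism of `ℂ`; since it preserves orthogonality, the endomorphism commutes with
  conjugation, so it fixes the reals and is the identity or the conjugation
  (`exists_ringHom_map_smul`), and the map is a multiple of an isometry (`exists_isometryEquiv`).
* For arbitrary `T` and `v`, an operator `F` of rank at most two makes `T - F` orthogonal to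
  `rankOne v v`. Orthogonality of the images says that `Φ T` and `Φ F` agree at one vector, and
  the value of `Φ F` there is known (`map_apply_of_factors`).

The argument takes place inside the inner product space `D`, where projections onto complex lines
are the only ones that occur.
-/

namespace UnboundedOp

/-! ### Additive maps that preserve orthogonality -/

section Additive

variable {E : Type*} [NormedAddCommGroup E] [InnerProductSpace ℂ E]

theorem mem_span_singleton_of_forall_inner {a b : E}
    (h : ∀ z, inner ℂ a z = 0 → inner ℂ b z = 0) : b ∈ Submodule.span ℂ {a} := by
  rw [← Submodule.orthogonal_orthogonal (Submodule.span ℂ {a})]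
  intro z hz
  exact inner_eq_zero_symm.1 (h z (Submodule.mem_orthogonal_singleton_iff_inner_right.1 hz))

theorem exists_smul_add_orthogonal {x : E} (hx : x ≠ 0) (y : E) :
    ∃ (c : ℂ) (w : E), inner ℂ x w = 0 ∧ y = c • x + w := by
  refine ⟨inner ℂ x y / inner ℂ x x, y - (inner ℂ x y / inner ℂ x x) • x, ?_, by abel⟩
  rw [inner_sub_right, inner_smul_right, div_mul_cancel₀ _ (inner_self_ne_zero.2 hx), sub_self]

/-- In a space of dimension other than one, every vector has a nonzero vector orthogonal to it,
provided that the space is not zero. -/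
theorem exists_ne_zero_inner_eq_zero [Nontrivial E] (h : Module.rank ℂ E ≠ 1) (x : E) :
    ∃ y : E, y ≠ 0 ∧ inner ℂ x y = 0 := by
  rcases eq_or_ne x 0 with rfl | hx
  · obtain ⟨y, hy⟩ := exists_ne (0 : E)
    exact ⟨y, hy, inner_zero_left y⟩
  by_contra! hcon
  refine h (rank_eq_one x hx fun y => ?_)
  obtain ⟨c, w, hw, rfl⟩ := exists_smul_add_orthogonal hx y
  have hw0 : w = 0 := by
    by_contra hne
    exact hcon w hne hw
  exact ⟨c, by rw [hw0, add_zero]⟩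

variable {f : E →+ E}

/-- The image of a vector `y = c • x + w` with `w ⊥ x` splits orthogonally in the same way, so
that `f` maps linearly independent pairs to linearly independent pairs. -/
theorem mem_span_of_map_mem_span (hline : ∀ (c : ℂ) (x : E), ∃ d : ℂ, f (c • x) = d • f x)
    (hinj : ∀ x, f x = 0 → x = 0)
    (horth : ∀ x y, inner ℂ x y = 0 → inner ℂ (f x) (f y) = 0)
    {x y : E} (hx : x ≠ 0) (h : f y ∈ Submodule.span ℂ {f x}) :
    y ∈ Submodule.span ℂ {x} := by
  obtain ⟨c, w, hw, rfl⟩ := exists_smul_add_orthogonal hx y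
  obtain ⟨d, hd⟩ := hline c x
  obtain ⟨e, he⟩ := Submodule.mem_span_singleton.1 h
  have hfw : f w = (e - d) • f x := by
    rw [sub_smul, he, map_add, hd, add_sub_cancel_left]
  have h0 : inner ℂ (f w) (f w) = 0 := by
    nth_rw 1 [hfw]
    rw [inner_smul_left, horth x w hw, mul_zero]
  rw [hinj w (inner_self_eq_zero.1 h0), add_zero]
  exact Submodule.smul_mem _ _ (Submodule.mem_span_singleton_self x)

/-- If `g x` is a multiple of `f x` for every `x`, then the factor is the same for all `x`: for
two linearly independent vectors `x`, `y` the factors agree because they agree with the factor of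
`x + y`, and in dimension at least two this suffices. -/
theorem exists_forall_eq_smul {g : E →+ E} (hE : ∀ x : E, ∃ y : E, y ≠ 0 ∧ inner ℂ x y = 0)
    (hline : ∀ (c : ℂ) (x : E), ∃ d : ℂ, f (c • x) = d • f x)
    (hinj : ∀ x, f x = 0 → x = 0)
    (horth : ∀ x y, inner ℂ x y = 0 → inner ℂ (f x) (f y) = 0)
    (hg : ∀ x, ∃ d : ℂ, g x = d • f x) : ∃ d : ℂ, ∀ x, g x = d • f x := by
  choose t ht using hg
  have key : ∀ x y, x ≠ 0 → y ∉ Submodule.span ℂ {x} → t x = t y := by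
    intro x y hx hy
    have hfy : f y ∉ Submodule.span ℂ {f x} := fun h =>
      hy (mem_span_of_map_mem_span hline hinj horth hx h)
    have h1 : t (x + y) • (f x + f y) = t x • f x + t y • f y := by
      rw [← map_add, ← ht, map_add, ht, ht]
    have h2 : (t y - t (x + y)) • f y = (t (x + y) - t x) • f x := by
      rw [smul_add] at h1
      rw [sub_smul, sub_smul, sub_eq_sub_iff_add_eq_add, add_comm, h1.symm, add_comm]
    have h3 : t y - t (x + y) = 0 := by
      by_contra hne
      refine hfy (Submodule.mem_span_singleton.2
        ⟨(t y - t (x + y))⁻¹ * (t (x + y) - t x), ?_⟩)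
      rw [mul_smul, ← h2, smul_smul, inv_mul_cancel₀ hne, one_smul]
    rw [h3, zero_smul] at h2
    rcases smul_eq_zero.1 h2.symm with h | h
    · rw [← sub_eq_zero.1 h, sub_eq_zero.1 h3]
    · exact absurd (hinj x h) hx
  obtain ⟨x₀, hx₀, -⟩ := hE 0
  obtain ⟨w, hw, hw₀⟩ := hE x₀
  have notMem : ∀ x, x ∈ Submodule.span ℂ {x₀} → w ∉ Submodule.span ℂ {x} := by
    intro x hx h
    obtain ⟨a, rfl⟩ := Submodule.mem_span_singleton.1 hx
    obtain ⟨b, hb⟩ := Submodule.mem_span_singleton.1 h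
    apply hw
    rw [← inner_self_eq_zero (𝕜 := ℂ)]
    nth_rw 1 [← hb]
    rw [inner_smul_left, inner_smul_left, hw₀, mul_zero, mul_zero]
  refine ⟨t x₀, fun x => ?_⟩
  rcases eq_or_ne x 0 with rfl | hx
  · simp
  rw [ht]
  congr 1
  by_cases hm : x ∈ Submodule.span ℂ {x₀}
  · rw [key x w hx (notMem x hm),
      key x₀ w hx₀ (notMem x₀ (Submodule.mem_span_singleton_self x₀))]
  · exact (key x₀ x hx₀ hm).symm

/-- The two vectors `x + c • y` and `-conj c • x + y` are orthogonal when `x ⊥ y` have the same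
norm; this is the relation that their images satisfy. -/
theorem map_conj_mul_inner_self {τ : ℂ → ℂ} (hτ : ∀ (c : ℂ) (x : E), f (c • x) = τ c • f x)
    (horth : ∀ x y, inner ℂ x y = 0 → inner ℂ (f x) (f y) = 0)
    {x y : E} (hxy : inner ℂ x y = 0) (hn : ‖x‖ = ‖y‖) (c : ℂ) :
    τ (starRingEnd ℂ c) * inner ℂ (f x) (f x)
      = starRingEnd ℂ (τ c) * inner ℂ (f y) (f y) := by
  have h := horth (x + c • y) (y - starRingEnd ℂ c • x) (by
    rw [inner_sub_right, inner_add_left, inner_add_left, inner_smul_left, inner_smul_left,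
      inner_smul_right, inner_smul_right, hxy, inner_eq_zero_symm.1 hxy,
      inner_self_eq_norm_sq_to_K, inner_self_eq_norm_sq_to_K, hn]
    ring)
  have hf := horth x y hxy
  rw [map_sub, map_add, hτ, hτ, inner_sub_right, inner_add_left, inner_add_left,
    inner_smul_left, inner_smul_left, inner_smul_right, inner_smul_right, hf,
    inner_eq_zero_symm.1 hf] at h
  linear_combination -h

theorem ringHom_eq_id_or_conj {σ : ℂ →+* ℂ}
    (h : ∀ c, σ (starRingEnd ℂ c) = starRingEnd ℂ (σ c)) :
    σ = RingHom.id ℂ ∨ σ = starRingEnd ℂ := by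
  have him : ∀ r : ℝ, (σ r).im = 0 := fun r =>
    Complex.conj_eq_iff_im.1 (by rw [← h, Complex.conj_ofReal])
  -- The restriction of `σ` to the reals is a ring endomorphism of `ℝ`, hence the identity.
  let g : ℝ →+* ℝ :=
    { toFun := fun r => (σ r).re
      map_one' := by simp
      map_zero' := by simp
      map_add' := by simp
      map_mul' := fun r s => by simp [him] }
  have hreal : ∀ r : ℝ, σ r = r := by
    intro r
    have hg : (σ r).re = r := RingHom.congr_fun (Subsingleton.elim g (RingHom.id ℝ)) r
    exact Complex.ext hg (by rw [him, Complex.ofReal_im])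
  let F : ℂ →ₐ[ℝ] ℂ := { σ with commutes' := hreal }
  rcases Complex.real_algHom_eq_id_or_conj F with hF | hF
  · exact Or.inl (RingHom.ext fun c => DFunLike.congr_fun hF c)
  · exact Or.inr (RingHom.ext fun c => DFunLike.congr_fun hF c)

/-- A surjective semilinear map that preserves orthogonality is a positive multiple of an
isometry. -/
theorem exists_isometryEquiv {σ : ℂ →+* ℂ} [RingHomInvPair σ σ]
    (hσn : ∀ c, ‖σ c‖ = ‖c‖) (hσr : ∀ r : ℝ, σ r = r)
    (hE : ∀ x : E, ∃ y : E, y ≠ 0 ∧ inner ℂ x y = 0)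
    (hf : ∀ (c : ℂ) (x : E), f (c • x) = σ c • f x) (hinj : ∀ x, f x = 0 → x = 0)
    (hsurj : ∀ a, ∃ x, a ∈ Submodule.span ℂ {f x})
    (horth : ∀ x y, inner ℂ x y = 0 → inner ℂ (f x) (f y) = 0) :
    ∃ (k : ℝ) (W : E ≃ₛₗᵢ[σ] E), 0 < k ∧ (∀ x, f x = (k : ℂ) • W x) ∧
      ∀ x y, inner ℂ (W x) (W y) = σ (inner ℂ x y) := by
  obtain ⟨e, he, -⟩ := hE 0
  have hfe : f e ≠ 0 := fun h => he (hinj e h)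
  have hk : 0 < ‖f e‖ / ‖e‖ := div_pos (norm_pos_iff.2 hfe) (norm_pos_iff.2 he)
  set k := ‖f e‖ / ‖e‖ with hkdef
  have hke : ‖f e‖ = k * ‖e‖ := by
    rw [hkdef, div_mul_cancel₀ _ (norm_ne_zero_iff.2 he)]
  have hfw : ∀ w, inner ℂ e w = 0 → ‖f w‖ = k * ‖w‖ := by
    intro w hw
    rcases eq_or_ne w 0 with rfl | hw0
    · simp
    have hwn : ‖w‖ ≠ 0 := norm_ne_zero_iff.2 hw0
    -- Rescale `w` to the norm of `e`.
    have h := map_conj_mul_inner_self (f := f) hf horth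
      (x := e) (y := ((‖e‖ / ‖w‖ : ℝ) : ℂ) • w)
      (by rw [inner_smul_right, hw, mul_zero])
      (by rw [norm_smul, Complex.norm_real, Real.norm_of_nonneg (by positivity),
            div_mul_cancel₀ _ hwn]) 1
    rw [map_one, map_one, map_one, one_mul, one_mul, hf, inner_self_eq_norm_sq_to_K,
      inner_self_eq_norm_sq_to_K] at h
    have h' : ‖f e‖ ^ 2 = ‖σ ((‖e‖ / ‖w‖ : ℝ) : ℂ) • f w‖ ^ 2 := by exact_mod_cast h
    rw [norm_smul, hσn, Complex.norm_real, Real.norm_of_nonneg (by positivity)] at h'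
    have h2 := (sq_eq_sq₀ (norm_nonneg _) (by positivity)).1 h'
    rw [hkdef, h2]
    have := norm_ne_zero_iff.2 he
    field_simp
  have hnorm : ∀ x, ‖f x‖ = k * ‖x‖ := by
    intro x
    obtain ⟨c, w, hw, rfl⟩ := exists_smul_add_orthogonal he x
    have h1 : inner ℂ (c • e) w = 0 := by rw [inner_smul_left, hw, mul_zero]
    have h2 := horth _ _ h1
    have h3 := norm_add_sq_eq_norm_sq_add_norm_sq_of_inner_eq_zero _ _ h1
    have h4 := norm_add_sq_eq_norm_sq_add_norm_sq_of_inner_eq_zero _ _ h2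
    have h5 : ‖f (c • e)‖ = k * ‖c • e‖ := by
      rw [hf, norm_smul, norm_smul, hσn, hke]; ring
    rw [← map_add, h5, hfw w hw] at h4
    refine (mul_self_inj (norm_nonneg _) (by positivity)).1 ?_
    rw [h4]
    linear_combination (-k ^ 2) * h3
  let g : E →ₛₗᵢ[σ] E :=
    { toFun := fun x => ((k⁻¹ : ℝ) : ℂ) • f x
      map_add' := fun x y => by rw [map_add, smul_add]
      map_smul' := fun c x => by rw [hf, smul_comm]
      norm_map' := fun x => by
        change ‖((k⁻¹ : ℝ) : ℂ) • f x‖ = ‖x‖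
        rw [norm_smul, Complex.norm_real, Real.norm_of_nonneg (by positivity), hnorm,
          inv_mul_cancel_left₀ hk.ne'] }
  have hkc : (k : ℂ) ≠ 0 := by exact_mod_cast hk.ne'
  have hfg : ∀ x, f x = (k : ℂ) • g x := by
    intro x
    change f x = (k : ℂ) • (((k⁻¹ : ℝ) : ℂ) • f x)
    rw [smul_smul, Complex.ofReal_inv, mul_inv_cancel₀ hkc, one_smul]
  have hgs : Function.Surjective g := by
    intro a
    obtain ⟨x, hx⟩ := hsurj a
    obtain ⟨d, hd⟩ := Submodule.mem_span_singleton.1 hx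
    refine ⟨σ (d * k) • x, ?_⟩
    rw [map_smulₛₗ, RingHomInvPair.comp_apply_eq, mul_smul, ← hfg, hd]
  refine ⟨k, LinearIsometryEquiv.ofSurjective g hgs, hk, hfg, fun x y => ?_⟩
  change inner ℂ (g x) (g y) = σ (inner ℂ x y)
  rcases eq_or_ne x 0 with rfl | hx
  · simp
  obtain ⟨c, w, hw, rfl⟩ := exists_smul_add_orthogonal hx y
  have hg0 : inner ℂ (g x) (g w) = 0 := by
    change inner ℂ (((k⁻¹ : ℝ) : ℂ) • f x) (((k⁻¹ : ℝ) : ℂ) • f w) = 0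
    rw [inner_smul_left, inner_smul_right, horth x w hw, mul_zero, mul_zero]
  have hxx : σ (inner ℂ x x) = inner ℂ (g x) (g x) := by
    rw [inner_self_eq_norm_sq_to_K, inner_self_eq_norm_sq_to_K, g.norm_map, map_pow]
    exact congrArg (· ^ 2) (hσr _)
  rw [map_add, map_smulₛₗ, inner_add_right, inner_add_right, inner_smul_right, inner_smul_right,
    hg0, hw, map_add, map_mul, map_zero, hxx]

/-- An additive, injective, orthogonality preserving map that maps complex lines into complex
lines is linear or conjugate linear. -/
theorem exists_ringHom_map_smul (hE : ∀ x : E, ∃ y : E, y ≠ 0 ∧ inner ℂ x y = 0)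
    (hline : ∀ (c : ℂ) (x : E), ∃ d : ℂ, f (c • x) = d • f x)
    (hinj : ∀ x, f x = 0 → x = 0)
    (horth : ∀ x y, inner ℂ x y = 0 → inner ℂ (f x) (f y) = 0) :
    ∃ σ : ℂ →+* ℂ, (σ = RingHom.id ℂ ∨ σ = starRingEnd ℂ) ∧
      ∀ (c : ℂ) (x : E), f (c • x) = σ c • f x := by
  have hsmul : ∀ c : ℂ, ∃ d : ℂ, ∀ x, f (c • x) = d • f x := fun c =>
    exists_forall_eq_smul (g := f.comp (DistribSMul.toAddMonoidHom E c)) hE hline hinj horth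
      (hline c)
  choose τ hτ using hsmul
  obtain ⟨e, he, -⟩ := hE 0
  have hfe : f e ≠ 0 := fun h => he (hinj e h)
  let σ : ℂ →+* ℂ :=
    { toFun := τ
      map_one' := smul_left_injective ℂ hfe (by simp [← hτ])
      map_zero' := smul_left_injective ℂ hfe (by simp [← hτ])
      map_add' := fun a b => smul_left_injective ℂ hfe (by
        simp only [add_smul, ← hτ, map_add])
      map_mul' := fun a b => smul_left_injective ℂ hfe (by
        simp only [mul_smul, ← hτ]) }
  have hσ : ∀ (c : ℂ) (x : E), f (c • x) = σ c • f x := hτ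
  refine ⟨σ, ringHom_eq_id_or_conj fun c => ?_, hσ⟩
  obtain ⟨w, hw, hew⟩ := hE e
  have h := map_conj_mul_inner_self (f := f) hσ horth
    (x := e) (y := ((‖e‖ / ‖w‖ : ℝ) : ℂ) • w)
    (by rw [inner_smul_right, hew, mul_zero])
    (by rw [norm_smul, Complex.norm_real, Real.norm_of_nonneg (by positivity),
          div_mul_cancel₀ _ (norm_ne_zero_iff.2 hw)])
  have h1 := h 1
  rw [map_one, map_one, map_one, one_mul, one_mul] at h1
  have hc := h c
  rw [← h1] at hc
  exact mul_right_cancel₀ (inner_self_ne_zero.2 hfe) hc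

end Additive

variable {H : Type*} [NormedAddCommGroup H] [InnerProductSpace ℂ H] {D : Submodule ℂ H}

/-! ### Rank one operators and orthogonality -/

/-- The operator `z ↦ ⟪y, z⟫ x` of rank at most one. It is linear in `x` and conjugate linear
in `y`. -/
noncomputable def rankOne (x y : D) : LPlus D :=
  ⟨(innerₛₗ ℂ y).smulRight x, (innerₛₗ ℂ x).smulRight y, fun z w => by
    change inner ℂ (inner ℂ y z • x) w = inner ℂ z (inner ℂ x w • y)
    rw [inner_smul_left, inner_smul_right, inner_conj_symm, mul_comm]⟩

theorem rankOne_apply (x y z : D) : (rankOne x y).1 z = inner ℂ y z • x := rfl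

theorem ext_apply {S T : LPlus D} (h : ∀ z, S.1 z = T.1 z) : S = T :=
  Subtype.ext (LinearMap.ext h)

theorem star_rankOne (x y : D) : star (rankOne x y) = rankOne y x :=
  star_unique fun z w => by
    rw [rankOne_apply, rankOne_apply, inner_smul_left, inner_smul_right, inner_conj_symm, mul_comm]

theorem rankOne_add_left (x x' y : D) : rankOne (x + x') y = rankOne x y + rankOne x' y :=
  ext_apply fun _ => smul_add _ _ _

theorem rankOne_smul_left (c : ℂ) (x y : D) : rankOne (c • x) y = c • rankOne x y :=
  ext_apply fun _ => smul_comm _ _ _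

theorem rankOne_add_right (x y y' : D) : rankOne x (y + y') = rankOne x y + rankOne x y' := by
  rw [← star_rankOne, rankOne_add_left, star_add, star_rankOne, star_rankOne]

theorem rankOne_smul_right (c : ℂ) (x y : D) :
    rankOne x (c • y) = starRingEnd ℂ c • rankOne x y := by
  rw [← star_rankOne, rankOne_smul_left, star_smul, star_rankOne, starRingEnd_apply]

theorem rankOne_eq_zero {x y : D} : rankOne x y = 0 ↔ x = 0 ∨ y = 0 := by
  constructor
  · intro h
    have h1 : inner ℂ y y • x = 0 := by
      rw [← rankOne_apply, h]; rfl
    rcases smul_eq_zero.1 h1 with h2 | h2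
    · exact Or.inr (inner_self_eq_zero.1 h2)
    · exact Or.inl h2
  · rintro (rfl | rfl)
    · exact ext_apply fun z => smul_zero _
    · exact ext_apply fun z => by rw [rankOne_apply, inner_zero_left, zero_smul]; rfl

theorem rankOne_left_injective {b : D} (hb : b ≠ 0) {x x' : D}
    (h : rankOne x b = rankOne x' b) : x = x' := by
  have h1 : inner ℂ b b • x = inner ℂ b b • x' := by
    rw [← rankOne_apply, h, rankOne_apply]
  exact smul_right_injective D (inner_self_ne_zero.2 hb) h1

theorem rankOne_mem_finiteRank (x y : D) : rankOne x y ∈ finiteRank D := by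
  have hle : LinearMap.range (rankOne x y).1 ≤ Submodule.span ℂ {x} := by
    rintro _ ⟨z, rfl⟩
    exact Submodule.smul_mem _ _ (Submodule.mem_span_singleton_self x)
  exact Submodule.finiteDimensional_of_le hle

theorem mul_rankOne (T : LPlus D) (x y : D) : T * rankOne x y = rankOne (T.1 x) y :=
  ext_apply fun _ => map_smul T.1 _ _

theorem Orthogonal.symm {S T : LPlus D} (h : Orthogonal S T) : Orthogonal T S :=
  ⟨by rw [← star_star (star T * S), star_mul, star_star, h.1, star_zero],
    by rw [← star_star (T * star S), star_mul, star_star, h.2, star_zero]⟩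

theorem Orthogonal.star {S T : LPlus D} (h : Orthogonal S T) : Orthogonal (star S) (star T) :=
  ⟨by rw [star_star]; exact h.2, by rw [star_star]; exact h.1⟩

theorem orthogonal_star_iff {S T : LPlus D} :
    Orthogonal (Star.star S) (Star.star T) ↔ Orthogonal S T :=
  ⟨fun h => by simpa only [star_star] using h.star, Orthogonal.star⟩

theorem orthogonal_rankOne_iff {T : LPlus D} {x y : D} (hx : x ≠ 0) (hy : y ≠ 0) :
    Orthogonal T (rankOne x y) ↔ (star T).1 x = 0 ∧ T.1 y = 0 := by
  rw [Orthogonal, star_rankOne, mul_rankOne, mul_rankOne, rankOne_eq_zero, rankOne_eq_zero,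
    or_iff_left hy, or_iff_left hx]

/-- The range of `T`; for a rank one operator `rankOne x y`, the line spanned by `x`. -/
def leftLine (T : LPlus D) : Submodule ℂ D := LinearMap.range T.1

/-- The range of `T⁺`; for a rank one operator `rankOne x y`, the line spanned by `y`. -/
noncomputable def rightLine (T : LPlus D) : Submodule ℂ D := leftLine (star T)

theorem leftLine_rankOne (x : D) {y : D} (hy : y ≠ 0) :
    leftLine (rankOne x y) = Submodule.span ℂ {x} := by
  apply le_antisymm
  · rintro _ ⟨z, rfl⟩
    exact Submodule.smul_mem _ _ (Submodule.mem_span_singleton_self x)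
  · rw [Submodule.span_singleton_le_iff_mem]
    refine ⟨(inner ℂ y y)⁻¹ • y, ?_⟩
    rw [rankOne_apply, inner_smul_right, inv_mul_cancel₀ (inner_self_ne_zero.2 hy), one_smul]

theorem rightLine_rankOne {x : D} (hx : x ≠ 0) (y : D) :
    rightLine (rankOne x y) = Submodule.span ℂ {y} := by
  rw [rightLine, star_rankOne, leftLine_rankOne y hx]

theorem rightLine_star (T : LPlus D) : rightLine (star T) = leftLine T := by
  rw [rightLine, star_star]

theorem Orthogonal.inner_eq_zero {S T : LPlus D} (h : Orthogonal S T) {u v : D}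
    (hu : u ∈ leftLine S) (hv : v ∈ leftLine T) : inner ℂ u v = 0 := by
  obtain ⟨x, rfl⟩ := hu
  obtain ⟨y, rfl⟩ := hv
  have h1 : (Star.star S).1 (T.1 y) = 0 := by
    change (Star.star S * T).1 y = 0
    rw [h.1]; rfl
  rw [inner_apply_left, h1, inner_zero_right]

theorem Orthogonal.eq_zero_of_leftLine_eq {S T : LPlus D} (h : Orthogonal S T)
    (hl : leftLine S = leftLine T) : S = 0 :=
  ext_apply fun z => inner_self_eq_zero.1
    (h.inner_eq_zero (u := S.1 z) (v := S.1 z) ⟨z, rfl⟩ (hl ▸ ⟨z, rfl⟩))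

theorem Orthogonal.eq_zero_of_rightLine_eq {S T : LPlus D} (h : Orthogonal S T)
    (hl : rightLine S = rightLine T) : S = 0 :=
  star_eq_zero.1 (h.star.eq_zero_of_leftLine_eq hl)

theorem span_singleton_eq_of_mem {E : Type*} [AddCommGroup E] [Module ℂ E] {a b : E} (ha : a ≠ 0)
    (h : a ∈ Submodule.span ℂ {b}) :
    Submodule.span ℂ {a} = Submodule.span ℂ {b} := by
  obtain ⟨c, rfl⟩ := Submodule.mem_span_singleton.1 h
  refine Submodule.span_singleton_smul_eq (IsUnit.mk0 c ?_) b
  rintro rfl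
  exact ha (zero_smul _ _)

/-- If the sum of two rank one operators has rank at most one, then the two operators have a
common range or their adjoints have one. -/
theorem leftLine_eq_or_rightLine_eq {a b a' b' a'' b'' : D} (ha : a ≠ 0) (hb : b ≠ 0)
    (ha' : a' ≠ 0) (hb' : b' ≠ 0) (h : rankOne a b + rankOne a' b' = rankOne a'' b'') :
    leftLine (rankOne a b) = leftLine (rankOne a' b') ∨
      rightLine (rankOne a b) = rightLine (rankOne a' b') := by
  rw [leftLine_rankOne _ hb, leftLine_rankOne _ hb', rightLine_rankOne ha, rightLine_rankOne ha']
  by_contra! hne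
  have key : ∀ {a b a' b' : D}, a ≠ 0 → b ≠ 0 →
      Submodule.span ℂ {b} ≠ Submodule.span ℂ {b'} →
      rankOne a b + rankOne a' b' = rankOne a'' b'' →
      Submodule.span ℂ {a} = Submodule.span ℂ {a''} := by
    intro a b a' b' ha hb hne h
    refine span_singleton_eq_of_mem ha ?_
    by_contra hmem
    refine hne (span_singleton_eq_of_mem hb (mem_span_singleton_of_forall_inner fun z hz => ?_))
    -- Evaluate at a vector `z ⊥ b'`.
    have h1 : inner ℂ b z • a + inner ℂ b' z • a' = inner ℂ b'' z • a'' := by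
      rw [← rankOne_apply, ← rankOne_apply, ← rankOne_apply, ← h]; rfl
    rw [hz, zero_smul, add_zero] at h1
    by_contra hbz
    refine hmem (Submodule.mem_span_singleton.2 ⟨(inner ℂ b z)⁻¹ * inner ℂ b'' z, ?_⟩)
    rw [mul_smul, ← h1, smul_smul, inv_mul_cancel₀ hbz, one_smul]
  exact hne.1 ((key ha hb hne.2 h).trans
    (key ha' hb' hne.2.symm ((add_comm _ _).trans h)).symm)

theorem forall_eq_or_forall_eq {ι X Y : Type*} {g : ι → X} {h : ι → Y}
    (H : ∀ i j, g i = g j ∨ h i = h j) : (∀ i j, g i = g j) ∨ (∀ i j, h i = h j) := by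
  by_contra! hne
  obtain ⟨⟨i, j, hij⟩, k, l, hkl⟩ := hne
  have := H i k
  have := H i l
  have := H j k
  have := H j l
  grind

/-! ### Orthogonality preserving bijections on rank one operators -/

-- Only the linear structure of `A` matters here, so `A` is any linear space of operators.
variable {A : Submodule ℂ (LPlus D)}

/-- `S` is dominated by `T` in `A`: everything in `A` that is orthogonal to `T` is orthogonal
to `S`. -/
def Dominated (S T : A) : Prop :=
  ∀ R : A, Orthogonal R.1 T.1 → Orthogonal R.1 S.1

/-- `Φ` preserves orthogonality in both directions. -/
def PreservesOrthogonality (Φ : A ≃+ A) : Prop :=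
  ∀ S T : A, Orthogonal S.1 T.1 ↔ Orthogonal (Φ S).1 (Φ T).1

/-- The rank one operator `rankOne x y` as an element of `A`. -/
noncomputable def mkRankOne (hA : ∀ x y : D, rankOne x y ∈ A) (x y : D) : A :=
  ⟨rankOne x y, hA x y⟩

variable {hA : ∀ x y : D, rankOne x y ∈ A}

theorem mkRankOne_ne_zero {x y : D} (hx : x ≠ 0) (hy : y ≠ 0) : mkRankOne hA x y ≠ 0 := by
  intro h
  rcases rankOne_eq_zero.1 (congrArg Subtype.val h) with h | h
  exacts [hx h, hy h]

theorem mkRankOne_add_left (x x' y : D) :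
    mkRankOne hA (x + x') y = mkRankOne hA x y + mkRankOne hA x' y :=
  Subtype.ext (rankOne_add_left x x' y)

theorem mkRankOne_add_right (x y y' : D) :
    mkRankOne hA x (y + y') = mkRankOne hA x y + mkRankOne hA x y' :=
  Subtype.ext (rankOne_add_right x y y')

theorem mkRankOne_smul_left (c : ℂ) (x y : D) :
    mkRankOne hA (c • x) y = c • mkRankOne hA x y :=
  Subtype.ext (rankOne_smul_left c x y)

theorem mkRankOne_zero_left (y : D) : mkRankOne hA 0 y = 0 :=
  Subtype.ext (rankOne_eq_zero.2 (Or.inl rfl))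

theorem mkRankOne_zero_right (x : D) : mkRankOne hA x 0 = 0 :=
  Subtype.ext (rankOne_eq_zero.2 (Or.inr rfl))

theorem orthogonal_mkRankOne {x y x' y' : D} (hx : inner ℂ x x' = 0) (hy : inner ℂ y y' = 0) :
    Orthogonal (mkRankOne hA x y).1 (mkRankOne hA x' y').1 := by
  change Orthogonal (rankOne x y) (rankOne x' y')
  rw [Orthogonal, star_rankOne, star_rankOne, mul_rankOne, mul_rankOne, rankOne_apply,
    rankOne_apply, hx, hy, zero_smul, zero_smul]
  exact ⟨rankOne_eq_zero.2 (Or.inl rfl), rankOne_eq_zero.2 (Or.inl rfl)⟩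

theorem dominated_smul (c : ℂ) (T : A) : Dominated (c • T) T := by
  intro R hR
  change Orthogonal R.1 (c • T.1)
  refine ⟨?_, ?_⟩
  · rw [mul_smul_comm, hR.1, smul_zero]
  · rw [star_smul, mul_smul_comm, hR.2, smul_zero]

theorem exists_smul_of_dominated (hD : ∀ x : D, ∃ y : D, y ≠ 0 ∧ inner ℂ x y = 0)
    {x y : D} {S : A} (h : Dominated S (mkRankOne hA x y)) :
    ∃ c : ℂ, S = c • mkRankOne hA x y := by
  rcases eq_or_ne y 0 with rfl | hy
  · have hS : Orthogonal S.1 S.1 := h S (by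
      rw [mkRankOne_zero_right]
      exact ⟨mul_zero _, by rw [ZeroMemClass.coe_zero, star_zero, mul_zero]⟩)
    exact ⟨0, by rw [zero_smul]; exact Subtype.ext (hS.eq_zero_of_leftLine_eq rfl)⟩
  have hker : ∀ u v : D, u ≠ 0 → v ≠ 0 → inner ℂ u x = 0 → inner ℂ v y = 0 →
      (star S.1).1 u = 0 ∧ S.1.1 v = 0 := fun u v hu hv hux hvy =>
    (orthogonal_rankOne_iff hu hv).1 (h (mkRankOne hA u v) (orthogonal_mkRankOne hux hvy)).symm
  have hkerS : ∀ v : D, inner ℂ y v = 0 → S.1.1 v = 0 := by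
    intro v hv
    rcases eq_or_ne v 0 with rfl | hv0
    · exact map_zero _
    obtain ⟨u, hu, hxu⟩ := hD x
    exact (hker u v hu hv0 (inner_eq_zero_symm.1 hxu) (inner_eq_zero_symm.1 hv)).2
  have hkerS' : ∀ u : D, inner ℂ x u = 0 → (star S.1).1 u = 0 := by
    intro u hu
    rcases eq_or_ne u 0 with rfl | hu0
    · exact map_zero _
    obtain ⟨v, hv, hyv⟩ := hD y
    exact (hker u v hu0 hv (inner_eq_zero_symm.1 hu) (inner_eq_zero_symm.1 hyv)).1
  have hmem : S.1.1 y ∈ Submodule.span ℂ {x} := mem_span_singleton_of_forall_inner fun u hu => by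
    rw [inner_apply_left, hkerS' u hu, inner_zero_right]
  obtain ⟨d, hd⟩ := Submodule.mem_span_singleton.1 hmem
  refine ⟨d / inner ℂ y y, Subtype.ext (ext_apply fun z => ?_)⟩
  obtain ⟨c, w, hw, rfl⟩ := exists_smul_add_orthogonal hy z
  change S.1.1 (c • y + w) = (d / inner ℂ y y) • (rankOne x y).1 (c • y + w)
  rw [map_add, map_smul, hkerS w hw, add_zero, ← hd, rankOne_apply, inner_add_right, hw, add_zero,
    inner_smul_right, smul_smul, smul_smul]
  congr 1
  have hyy : inner ℂ y y ≠ 0 := inner_self_ne_zero.2 hy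
  field_simp

theorem exists_dominated_mkRankOne {T : A} (hT : T ≠ 0) :
    ∃ x y : D, x ≠ 0 ∧ y ≠ 0 ∧ Dominated (mkRankOne hA x y) T := by
  have key : ∀ S : LPlus D, S ≠ 0 → ∃ z, S.1 z ≠ 0 := by
    intro S hS
    by_contra! h
    exact hS (ext_apply h)
  have hT' : T.1 ≠ 0 := fun h => hT (Subtype.ext h)
  obtain ⟨u, hu⟩ := key T.1 hT'
  obtain ⟨v, hv⟩ := key (star T.1) (star_ne_zero.2 hT')
  refine ⟨_, _, hu, hv, fun R hR => (orthogonal_rankOne_iff hu hv).2 ⟨?_, ?_⟩⟩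
  · change (star R.1 * T.1).1 u = 0
    rw [hR.1]; rfl
  · change (R.1 * star T.1).1 v = 0
    rw [hR.2]; rfl

variable {Φ : A ≃+ A}

theorem addEquiv_map_add (Φ : A ≃+ A) (S T : A) : Φ (S + T) = Φ S + Φ T := Φ.map_add' S T

theorem addEquiv_map_zero (Φ : A ≃+ A) : Φ 0 = 0 := AddEquiv.map_zero Φ

theorem addEquiv_map_eq_zero_iff (Φ : A ≃+ A) {T : A} : Φ T = 0 ↔ T = 0 :=
  AddEquiv.map_eq_zero_iff Φ

theorem PreservesOrthogonality.symm (hΦ : PreservesOrthogonality Φ) :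
    PreservesOrthogonality Φ.symm := fun S T => by
  rw [hΦ (Φ.symm S), Φ.apply_symm_apply, Φ.apply_symm_apply]

/-- The involution as an additive bijection of a *-invariant linear space of operators. -/
noncomputable def starEquiv (hA' : ∀ T ∈ A, star T ∈ A) : A ≃+ A where
  toFun T := ⟨star T.1, hA' T.1 T.2⟩
  invFun T := ⟨star T.1, hA' T.1 T.2⟩
  left_inv T := Subtype.ext (star_star T.1)
  right_inv T := Subtype.ext (star_star T.1)
  map_add' S T := Subtype.ext (star_add S.1 T.1)

theorem starEquiv_mkRankOne (hA' : ∀ T ∈ A, star T ∈ A) (x y : D) :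
    starEquiv hA' (mkRankOne hA x y) = mkRankOne hA y x :=
  Subtype.ext (star_rankOne x y)

theorem PreservesOrthogonality.starEquiv_trans (hΦ : PreservesOrthogonality Φ)
    (hA' : ∀ T ∈ A, star T ∈ A) : PreservesOrthogonality ((starEquiv hA').trans Φ) := fun S T =>
  orthogonal_star_iff.symm.trans (hΦ (starEquiv hA' S) (starEquiv hA' T))

theorem PreservesOrthogonality.trans_starEquiv (hΦ : PreservesOrthogonality Φ)
    (hA' : ∀ T ∈ A, star T ∈ A) : PreservesOrthogonality (Φ.trans (starEquiv hA')) := fun S T =>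
  (hΦ S T).trans orthogonal_star_iff.symm

theorem PreservesOrthogonality.dominated (hΦ : PreservesOrthogonality Φ) {S T : A}
    (h : Dominated S T) : Dominated (Φ S) (Φ T) := by
  intro R hR
  rw [← Φ.apply_symm_apply R, ← hΦ] at hR ⊢
  exact h _ hR

/-- The rank one operators are the minimal elements for domination among the nonzero operators,
so they are mapped to rank one operators. -/
theorem PreservesOrthogonality.exists_map_mkRankOne (hΦ : PreservesOrthogonality Φ)
    (hD : ∀ x : D, ∃ y : D, y ≠ 0 ∧ inner ℂ x y = 0) {x y : D} (hx : x ≠ 0) (hy : y ≠ 0) :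
    ∃ a b : D, a ≠ 0 ∧ b ≠ 0 ∧ Φ (mkRankOne hA x y) = mkRankOne hA a b := by
  obtain ⟨a, b, ha, hb, hab⟩ := exists_dominated_mkRankOne (hA := hA)
    ((addEquiv_map_eq_zero_iff Φ).not.2 (mkRankOne_ne_zero hx hy) : Φ (mkRankOne hA x y) ≠ 0)
  have h1 := hΦ.symm.dominated hab
  rw [Φ.symm_apply_apply] at h1
  obtain ⟨c, hc⟩ := exists_smul_of_dominated hD h1
  have hc0 : c ≠ 0 := by
    rintro rfl
    rw [zero_smul, addEquiv_map_eq_zero_iff] at hc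
    exact mkRankOne_ne_zero ha hb hc
  have h2 := hΦ.dominated (dominated_smul c⁻¹ (Φ.symm (mkRankOne hA a b)))
  rw [hc, smul_smul, inv_mul_cancel₀ hc0, one_smul, ← hc, Φ.apply_symm_apply] at h2
  obtain ⟨d, hd⟩ := exists_smul_of_dominated hD h2
  refine ⟨d • a, b, ?_, hb, by rw [hd, mkRankOne_smul_left]⟩
  rw [smul_ne_zero_iff]
  refine ⟨?_, ha⟩
  rintro rfl
  rw [zero_smul, addEquiv_map_eq_zero_iff] at hd
  exact mkRankOne_ne_zero hx hy hd

/-! ### Splitting of the action on pairs of lines -/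

/-- `Φ` acts on rank one operators `rankOne x y` factorwise: the range of the image depends only
on `x`, and the range of its adjoint depends only on `y`. -/
structure IsSplit (hA : ∀ x y : D, rankOne x y ∈ A) (Φ : A ≃+ A) : Prop where
  left : ∀ x y y' : D, x ≠ 0 → y ≠ 0 → y' ≠ 0 →
    leftLine (Φ (mkRankOne hA x y)).1 = leftLine (Φ (mkRankOne hA x y')).1
  right : ∀ x x' y : D, x ≠ 0 → x' ≠ 0 → y ≠ 0 →
    rightLine (Φ (mkRankOne hA x y)).1 = rightLine (Φ (mkRankOne hA x' y)).1

theorem PreservesOrthogonality.line_eq_or_line_eq (hΦ : PreservesOrthogonality Φ)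
    (hD : ∀ x : D, ∃ y : D, y ≠ 0 ∧ inner ℂ x y = 0) {x y x' y' u v : D} (hx : x ≠ 0)
    (hy : y ≠ 0) (hx' : x' ≠ 0) (hy' : y' ≠ 0)
    (h : mkRankOne hA x y + mkRankOne hA x' y' = mkRankOne hA u v) :
    leftLine (Φ (mkRankOne hA x y)).1 = leftLine (Φ (mkRankOne hA x' y')).1 ∨
      rightLine (Φ (mkRankOne hA x y)).1 = rightLine (Φ (mkRankOne hA x' y')).1 := by
  have hsum := congrArg Φ h
  rw [addEquiv_map_add] at hsum
  obtain ⟨a, b, ha, hb, hab⟩ := hΦ.exists_map_mkRankOne (hA := hA) hD hx hy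
  obtain ⟨a', b', ha', hb', hab'⟩ := hΦ.exists_map_mkRankOne (hA := hA) hD hx' hy'
  have huv : ∃ a'' b'', Φ (mkRankOne hA u v) = mkRankOne hA a'' b'' := by
    rcases eq_or_ne u 0 with rfl | hu
    · exact ⟨0, 0, by rw [mkRankOne_zero_left, mkRankOne_zero_left, addEquiv_map_zero]⟩
    rcases eq_or_ne v 0 with rfl | hv
    · exact ⟨0, 0, by rw [mkRankOne_zero_right, mkRankOne_zero_right, addEquiv_map_zero]⟩
    obtain ⟨a'', b'', -, -, h''⟩ := hΦ.exists_map_mkRankOne (hA := hA) hD hu hv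
    exact ⟨a'', b'', h''⟩
  obtain ⟨a'', b'', hab''⟩ := huv
  rw [hab, hab', hab''] at hsum
  rw [hab, hab']
  exact leftLine_eq_or_rightLine_eq ha hb ha' hb' (congrArg Subtype.val hsum)

/-- Choose `x' ⊥ x` and `y' ⊥ y`. The images of `rankOne x' y` and `rankOne x y'` are orthogonal,
so their adjoints cannot both have the same range as that of the image of `rankOne x y`. -/
theorem PreservesOrthogonality.not_rightLine_eq (hΦ : PreservesOrthogonality Φ)
    (hD : ∀ x : D, ∃ y : D, y ≠ 0 ∧ inner ℂ x y = 0) (x y : D)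
    (h1 : ∀ x', x' ≠ 0 →
      rightLine (Φ (mkRankOne hA x' y)).1 = rightLine (Φ (mkRankOne hA x y)).1)
    (h2 : ∀ y', y' ≠ 0 →
      rightLine (Φ (mkRankOne hA x y')).1 = rightLine (Φ (mkRankOne hA x y)).1)
    (hy : y ≠ 0) : False := by
  obtain ⟨x', hx', hxx'⟩ := hD x
  obtain ⟨y', hy', hyy'⟩ := hD y
  have horth := (hΦ _ _).1 (orthogonal_mkRankOne (hA := hA) (inner_eq_zero_symm.1 hxx') hyy')
  have h0 := horth.eq_zero_of_rightLine_eq ((h1 x' hx').trans (h2 y' hy').symm)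
  exact (addEquiv_map_eq_zero_iff Φ).not.2 (mkRankOne_ne_zero hx' hy) (Subtype.ext h0)

theorem PreservesOrthogonality.not_leftLine_eq (hΦ : PreservesOrthogonality Φ)
    (hD : ∀ x : D, ∃ y : D, y ≠ 0 ∧ inner ℂ x y = 0) (x y : D)
    (h1 : ∀ x', x' ≠ 0 →
      leftLine (Φ (mkRankOne hA x' y)).1 = leftLine (Φ (mkRankOne hA x y)).1)
    (h2 : ∀ y', y' ≠ 0 →
      leftLine (Φ (mkRankOne hA x y')).1 = leftLine (Φ (mkRankOne hA x y)).1)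
    (hy : y ≠ 0) : False := by
  obtain ⟨x', hx', hxx'⟩ := hD x
  obtain ⟨y', hy', hyy'⟩ := hD y
  have horth := (hΦ _ _).1 (orthogonal_mkRankOne (hA := hA) (inner_eq_zero_symm.1 hxx') hyy')
  have h0 := horth.eq_zero_of_leftLine_eq ((h1 x' hx').trans (h2 y' hy').symm)
  exact (addEquiv_map_eq_zero_iff Φ).not.2 (mkRankOne_ne_zero hx' hy) (Subtype.ext h0)

/-- On the operators `rankOne x y` with fixed `y` either all images have the same range or all
their adjoints have, and likewise for fixed `x`. No choice for some `y` is compatible with the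
same choice for some `x`, so that the choice is uniform. -/
theorem PreservesOrthogonality.isSplit_or_isSplit (hΦ : PreservesOrthogonality Φ)
    (hA' : ∀ T ∈ A, star T ∈ A) (hD : ∀ x : D, ∃ y : D, y ≠ 0 ∧ inner ℂ x y = 0) :
    IsSplit hA Φ ∨ IsSplit hA ((starEquiv hA').trans Φ) := by
  have hrow : ∀ y : D, y ≠ 0 →
      (∀ x x' : {x : D // x ≠ 0}, leftLine (Φ (mkRankOne hA x y)).1
        = leftLine (Φ (mkRankOne hA x' y)).1) ∨
      (∀ x x' : {x : D // x ≠ 0}, rightLine (Φ (mkRankOne hA x y)).1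
        = rightLine (Φ (mkRankOne hA x' y)).1) := fun y hy =>
    forall_eq_or_forall_eq fun x x' => hΦ.line_eq_or_line_eq hD x.2 hy x'.2 hy
      (mkRankOne_add_left _ _ _).symm
  have hcol : ∀ x : D, x ≠ 0 →
      (∀ y y' : {y : D // y ≠ 0}, leftLine (Φ (mkRankOne hA x y)).1
        = leftLine (Φ (mkRankOne hA x y')).1) ∨
      (∀ y y' : {y : D // y ≠ 0}, rightLine (Φ (mkRankOne hA x y)).1
        = rightLine (Φ (mkRankOne hA x y')).1) := fun x hx =>
    forall_eq_or_forall_eq fun y y' => hΦ.line_eq_or_line_eq hD hx y.2 hx y'.2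
      (mkRankOne_add_right _ _ _).symm
  obtain ⟨e, he, -⟩ := hD 0
  rcases hrow e he with hl | hr
  · have hcolR : ∀ x : D, x ≠ 0 → ∀ y y' : {y : D // y ≠ 0},
        rightLine (Φ (mkRankOne hA x y)).1 = rightLine (Φ (mkRankOne hA x y')).1 :=
      fun x hx => (hcol x hx).resolve_left fun h => hΦ.not_leftLine_eq hD x e
        (fun x' hx' => hl ⟨x', hx'⟩ ⟨x, hx⟩) (fun y' hy' => h ⟨y', hy'⟩ ⟨e, he⟩) he
    have hrowL : ∀ y : D, y ≠ 0 → ∀ x x' : {x : D // x ≠ 0},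
        leftLine (Φ (mkRankOne hA x y)).1 = leftLine (Φ (mkRankOne hA x' y)).1 :=
      fun y hy => (hrow y hy).resolve_right fun h => hΦ.not_rightLine_eq hD e y
        (fun x' hx' => h ⟨x', hx'⟩ ⟨e, he⟩) (fun y' hy' => hcolR e he ⟨y', hy'⟩ ⟨y, hy⟩) hy
    refine Or.inr ⟨fun x y y' hx hy hy' => ?_, fun x x' y hx hx' hy => ?_⟩
    · simp only [AddEquiv.trans_apply, starEquiv_mkRankOne]
      exact hrowL x hx ⟨y, hy⟩ ⟨y', hy'⟩
    · simp only [AddEquiv.trans_apply, starEquiv_mkRankOne]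
      exact hcolR y hy ⟨x, hx⟩ ⟨x', hx'⟩
  · have hcolL : ∀ x : D, x ≠ 0 → ∀ y y' : {y : D // y ≠ 0},
        leftLine (Φ (mkRankOne hA x y)).1 = leftLine (Φ (mkRankOne hA x y')).1 :=
      fun x hx => (hcol x hx).resolve_right fun h => hΦ.not_rightLine_eq hD x e
        (fun x' hx' => hr ⟨x', hx'⟩ ⟨x, hx⟩) (fun y' hy' => h ⟨y', hy'⟩ ⟨e, he⟩) he
    have hrowR : ∀ y : D, y ≠ 0 → ∀ x x' : {x : D // x ≠ 0},
        rightLine (Φ (mkRankOne hA x y)).1 = rightLine (Φ (mkRankOne hA x' y)).1 :=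
      fun y hy => (hrow y hy).resolve_left fun h => hΦ.not_leftLine_eq hD e y
        (fun x' hx' => h ⟨x', hx'⟩ ⟨e, he⟩) (fun y' hy' => hcolL e he ⟨y', hy'⟩ ⟨y, hy⟩) hy
    exact Or.inl ⟨fun x y y' hx hy hy' => hcolL x hx ⟨y, hy⟩ ⟨y', hy'⟩,
      fun x x' y hx hx' hy => hrowR y hy ⟨x, hx⟩ ⟨x', hx'⟩⟩

/-- Conjugating `Φ` by the involution exchanges the roles of the two factors. -/
theorem IsSplit.conj_star (hs : IsSplit hA Φ) (hA' : ∀ T ∈ A, star T ∈ A) :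
    IsSplit hA (((starEquiv hA').trans Φ).trans (starEquiv hA')) := by
  refine ⟨fun x y y' hx hy hy' => ?_, fun x x' y hx hx' hy => ?_⟩
  · simp only [AddEquiv.trans_apply, starEquiv_mkRankOne]
    exact hs.right y y' x hy hy' hx
  · simp only [AddEquiv.trans_apply, starEquiv_mkRankOne]
    exact (rightLine_star _).trans ((hs.left y x x' hy hx hx').trans (rightLine_star _).symm)

/-! ### The two factors of a split map -/

/-- An additive map that preserves orthogonality and maps complex lines onto complex lines. -/
structure PreservesLines (f : D →+ D) : Prop where
  exists_map_smul : ∀ (c : ℂ) (x : D), ∃ d : ℂ, f (c • x) = d • f x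
  eq_zero : ∀ x, f x = 0 → x = 0
  exists_mem_span : ∀ a, ∃ x, a ∈ Submodule.span ℂ {f x}
  inner_eq_zero : ∀ x y, inner ℂ x y = 0 → inner ℂ (f x) (f y) = 0

theorem PreservesOrthogonality.exists_left_factor (hΦ : PreservesOrthogonality Φ)
    (hD : ∀ x : D, ∃ y : D, y ≠ 0 ∧ inner ℂ x y = 0) {y b : D} (hy : y ≠ 0) (hb : b ≠ 0)
    (hby : ∀ x, x ≠ 0 → b ∈ rightLine (Φ (mkRankOne hA x y)).1) :
    ∃ f : D →+ D, ∀ x, Φ (mkRankOne hA x y) = mkRankOne hA (f x) b := by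
  have h : ∀ x, ∃ a, Φ (mkRankOne hA x y) = mkRankOne hA a b := by
    intro x
    rcases eq_or_ne x 0 with rfl | hx
    · exact ⟨0, by rw [mkRankOne_zero_left, mkRankOne_zero_left, addEquiv_map_zero]⟩
    obtain ⟨a, b', ha, hb', hab⟩ := hΦ.exists_map_mkRankOne (hA := hA) hD hx hy
    have hmem : b ∈ Submodule.span ℂ {b'} := by
      rw [← rightLine_rankOne ha b']
      exact congrArg (fun T : A => rightLine T.1) hab ▸ hby x hx
    have hb'mem : b' ∈ Submodule.span ℂ {b} := by
      rw [span_singleton_eq_of_mem hb hmem]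
      exact Submodule.mem_span_singleton_self b'
    obtain ⟨c, rfl⟩ := Submodule.mem_span_singleton.1 hb'mem
    refine ⟨starRingEnd ℂ c • a, hab.trans (Subtype.ext ?_)⟩
    exact (rankOne_smul_right c a b).trans (rankOne_smul_left _ a b).symm
  choose f hf using h
  refine ⟨AddMonoidHom.mk' f fun x x' => ?_, hf⟩
  have h : mkRankOne hA (f (x + x')) b = mkRankOne hA (f x + f x') b := by
    rw [← hf, mkRankOne_add_left, addEquiv_map_add, hf, hf, mkRankOne_add_left]
  exact rankOne_left_injective hb (congrArg Subtype.val h)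

theorem IsSplit.preservesLines (hs : IsSplit hA Φ) (hΦ : PreservesOrthogonality Φ)
    (hD : ∀ x : D, ∃ y : D, y ≠ 0 ∧ inner ℂ x y = 0) {y b : D} (hy : y ≠ 0) (hb : b ≠ 0)
    {f : D →+ D} (hf : ∀ x, Φ (mkRankOne hA x y) = mkRankOne hA (f x) b) :
    PreservesLines f := by
  have hline : ∀ x, leftLine (Φ (mkRankOne hA x y)).1 = Submodule.span ℂ {f x} := fun x => by
    rw [hf]
    exact leftLine_rankOne _ hb
  refine ⟨fun c x => ?_, fun x hx => ?_, fun a => ?_, fun x x' hxx' => ?_⟩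
  · have h := hΦ.dominated (dominated_smul c (mkRankOne hA x y))
    rw [hf] at h
    obtain ⟨d, hd⟩ := exists_smul_of_dominated hD h
    rw [← mkRankOne_smul_left, hf, ← mkRankOne_smul_left] at hd
    exact ⟨d, rankOne_left_injective hb (congrArg Subtype.val hd)⟩
  · by_contra hne
    have h := hf x
    rw [hx, mkRankOne_zero_left, addEquiv_map_eq_zero_iff] at h
    exact mkRankOne_ne_zero hne hy h
  · rcases eq_or_ne a 0 with rfl | ha
    · exact ⟨0, Submodule.zero_mem _⟩
    obtain ⟨x, y', hx, hy', hxy⟩ := hΦ.symm.exists_map_mkRankOne (hA := hA) hD ha hb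
    refine ⟨x, ?_⟩
    rw [← hline, hs.left x y y' hx hy hy', ← hxy, Φ.apply_symm_apply]
    exact leftLine_rankOne a hb ▸ Submodule.mem_span_singleton_self a
  · rcases eq_or_ne x 0 with rfl | hx
    · rw [map_zero, inner_zero_left]
    rcases eq_or_ne x' 0 with rfl | hx'
    · rw [map_zero, inner_zero_right]
    obtain ⟨y', hy', hyy'⟩ := hD y
    have horth := (hΦ _ _).1 (orthogonal_mkRankOne (hA := hA) hxx' hyy')
    refine horth.inner_eq_zero ?_ ?_
    · rw [hline]
      exact Submodule.mem_span_singleton_self _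
    · rw [← hs.left x' y y' hx' hy hy', hline]
      exact Submodule.mem_span_singleton_self _

/-- With `y` fixed, the image of `rankOne x y` has a first factor that is additive in `x`, and for
different `y` these first factors are pointwise proportional, hence proportional. Normalizing at
one vector `e` makes them equal. -/
theorem IsSplit.exists_factors (hs : IsSplit hA Φ) (hΦ : PreservesOrthogonality Φ)
    (hA' : ∀ T ∈ A, star T ∈ A) (hD : ∀ x : D, ∃ y : D, y ≠ 0 ∧ inner ℂ x y = 0) :
    ∃ f g : D →+ D, PreservesLines f ∧ PreservesLines g ∧
      ∀ x y, Φ (mkRankOne hA x y) = mkRankOne hA (f x) (g y) := by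
  obtain ⟨e, he, -⟩ := hD 0
  obtain ⟨a, b, ha, hb, hab⟩ := hΦ.exists_map_mkRankOne (hA := hA) hD he he
  have hright : rightLine (mkRankOne hA a b).1 = Submodule.span ℂ {b} := rightLine_rankOne ha b
  obtain ⟨f, hf⟩ := hΦ.exists_left_factor (hA := hA) hD he hb (fun x hx => by
    rw [hs.right x e e hx he he, hab, hright]
    exact Submodule.mem_span_singleton_self b)
  have hfl := hs.preservesLines hΦ hD he hb hf
  have hfe : f e = a :=
    rankOne_left_injective hb (congrArg Subtype.val ((hf e).symm.trans hab))
  -- The second factor is the first factor of the conjugate of `Φ` by the involution.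
  set Ψ := ((starEquiv hA').trans Φ).trans (starEquiv hA') with hΨ
  have hΨo : PreservesOrthogonality Ψ := (hΦ.starEquiv_trans hA').trans_starEquiv hA'
  have hΨapply : ∀ x y, Ψ (mkRankOne hA y x) = starEquiv hA' (Φ (mkRankOne hA x y)) := by
    intro x y
    rw [hΨ, AddEquiv.trans_apply, AddEquiv.trans_apply, starEquiv_mkRankOne]
  have hΨs : IsSplit hA Ψ := hs.conj_star hA'
  obtain ⟨g, hg⟩ := hΨo.exists_left_factor (hA := hA) hD he ha (fun y hy => by
    rw [hΨs.right y e e hy he he, hΨapply, hab, starEquiv_mkRankOne]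
    exact rightLine_rankOne hb a ▸ Submodule.mem_span_singleton_self a)
  have hgl := hΨs.preservesLines hΨo hD he ha hg
  have hg' : ∀ y, Φ (mkRankOne hA e y) = mkRankOne hA a (g y) := by
    intro y
    apply (starEquiv hA').injective
    rw [← hΨapply, hg, starEquiv_mkRankOne]
  refine ⟨f, g, hfl, hgl, fun x y => ?_⟩
  rcases eq_or_ne y 0 with rfl | hy
  · rw [map_zero, mkRankOne_zero_right, mkRankOne_zero_right, addEquiv_map_zero]
  have hgy : g y ≠ 0 := fun h => hy (hgl.eq_zero y h)
  obtain ⟨h, hh⟩ := hΦ.exists_left_factor (hA := hA) hD hy hgy (fun x hx => by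
    rw [hs.right x e y hx he hy, hg']
    exact rightLine_rankOne ha (g y) ▸ Submodule.mem_span_singleton_self (g y))
  have hhf : ∀ x, ∃ d : ℂ, h x = d • f x := by
    intro x
    rcases eq_or_ne x 0 with rfl | hx
    · exact ⟨0, by rw [map_zero, zero_smul]⟩
    have h1 := hs.left x y e hx hy he
    rw [hh, hf] at h1
    have h2 : Submodule.span ℂ {h x} = Submodule.span ℂ {f x} :=
      (leftLine_rankOne (h x) hgy).symm.trans (h1.trans (leftLine_rankOne (f x) hb))
    obtain ⟨d, hd⟩ := Submodule.mem_span_singleton.1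
      (h2 ▸ Submodule.mem_span_singleton_self (h x))
    exact ⟨d, hd.symm⟩
  obtain ⟨d, hd⟩ := exists_forall_eq_smul hD hfl.exists_map_smul hfl.eq_zero hfl.inner_eq_zero hhf
  have hhe : h e = a :=
    rankOne_left_injective hgy (congrArg Subtype.val ((hh e).symm.trans (hg' y)))
  have hd1 : d = 1 := smul_left_injective ℂ ha (by
    change d • a = (1 : ℂ) • a
    rw [one_smul, ← hfe, ← hd, hhe, hfe])
  rw [hh, hd, hd1, one_smul]

/-! ### From rank one operators to the whole algebra -/

/-- There is an operator `F` of rank at most two with `F v = T v` and `F⁺ u = T⁺ u`; then `T - F`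
is orthogonal to `rankOne u v`. The statement provides `-F` as a sum of two rank one operators. -/
theorem exists_orthogonal_add (T : LPlus D) {u v : D} (hu : u ≠ 0) (hv : v ≠ 0) :
    ∃ p w q : D, Orthogonal (T + (rankOne u p + rankOne w q)) (rankOne u v) := by
  have huu : inner ℂ u u ≠ 0 := inner_self_ne_zero.2 hu
  have hvv : inner ℂ v v ≠ 0 := inner_self_ne_zero.2 hv
  obtain ⟨c, w, huw, hTv⟩ := exists_smul_add_orthogonal hu (T.1 v)
  have hc : inner ℂ ((star T).1 u) v = c * inner ℂ u u := by
    rw [inner_apply_left, star_star, hTv, inner_add_right, huw, add_zero, inner_smul_right]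
  refine ⟨-(inner ℂ u u)⁻¹ • (star T).1 u, w, -(inner ℂ v v)⁻¹ • v,
    (orthogonal_rankOne_iff hu hv).2 ⟨?_, ?_⟩⟩
  · rw [star_add, star_add, star_rankOne, star_rankOne]
    change (star T).1 u + ((rankOne _ u).1 u + (rankOne _ w).1 u) = 0
    rw [rankOne_apply, rankOne_apply, inner_eq_zero_symm.1 huw, zero_smul, add_zero, smul_smul,
      mul_neg, mul_inv_cancel₀ huu, neg_one_smul, add_neg_cancel]
  · change T.1 v + ((rankOne u _).1 v + (rankOne w _).1 v) = 0
    rw [rankOne_apply, rankOne_apply, inner_smul_left, inner_smul_left, map_neg, map_neg, map_inv₀,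
      map_inv₀, inner_conj_symm, inner_conj_symm, neg_mul, neg_mul, inv_mul_cancel₀ hvv,
      neg_one_smul, hc, mul_comm c, inv_mul_cancel_left₀ huu, neg_smul, ← neg_add, hTv,
      add_neg_cancel]

/-- For an operator `F` of finite rank, `Φ F` is determined by the action of `Φ` on rank one
operators. For arbitrary `T` and a vector `v`, choose `F` such that `T - F` is orthogonal to
`rankOne v v`. Then `Φ T - Φ F` is orthogonal to the image of `rankOne v v`, so that `Φ T` and
`Φ F` agree at `W v`. -/
theorem map_apply_of_factors {σ : ℂ →+* ℂ} [RingHomInvPair σ σ] (hΦ : PreservesOrthogonality Φ)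
    {k l : ℝ} {U W : D ≃ₛₗᵢ[σ] D} (hk : 0 < k) (hl : 0 < l)
    (hW : ∀ x y, inner ℂ (W x) (W y) = σ (inner ℂ x y)) {f g : D →+ D}
    (hf : ∀ x, f x = (k : ℂ) • U x) (hg : ∀ x, g x = (l : ℂ) • W x)
    (hfg : ∀ x y, Φ (mkRankOne hA x y) = mkRankOne hA (f x) (g y)) (T : A) (z : D) :
    (Φ T).1.1 z = ((k * l : ℝ) : ℂ) • U (T.1.1 (W.symm z)) := by
  have hkc : (k : ℂ) ≠ 0 := by exact_mod_cast hk.ne'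
  have hlc : (l : ℂ) ≠ 0 := by exact_mod_cast hl.ne'
  obtain ⟨v, rfl⟩ := W.surjective z
  rw [W.symm_apply_apply]
  rcases eq_or_ne v 0 with rfl | hv
  · simp only [map_zero, smul_zero]
  have hrank : ∀ x y, (Φ (mkRankOne hA x y)).1.1 (W v)
      = ((k * l : ℝ) : ℂ) • U ((rankOne x y).1 v) := by
    intro x y
    rw [hfg]
    change (rankOne (f x) (g y)).1 (W v) = _
    rw [rankOne_apply, rankOne_apply, hf, hg, inner_smul_left, hW, Complex.conj_ofReal, map_smulₛₗ,
      smul_smul, smul_smul]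
    congr 1
    push_cast
    ring
  obtain ⟨p, w, q, horth⟩ := exists_orthogonal_add T.1 hv hv
  have hTv : (T.1 + (rankOne v p + rankOne w q)).1 v = 0 :=
    ((orthogonal_rankOne_iff hv hv).1 horth).2
  have horth' : Orthogonal (T + (mkRankOne hA v p + mkRankOne hA w q)).1 (mkRankOne hA v v).1 :=
    horth
  have hfv : f v ≠ 0 := by
    rw [hf]
    exact smul_ne_zero hkc ((map_ne_zero_iff U U.injective).2 hv)
  have hWv : W v ≠ 0 := (map_ne_zero_iff W W.injective).2 hv
  have hgv : g v ≠ 0 := by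
    rw [hg]
    exact smul_ne_zero hlc hWv
  rw [hΦ, hfg, addEquiv_map_add, addEquiv_map_add] at horth'
  have h0 := ((orthogonal_rankOne_iff hfv hgv).1 horth').2
  rw [hg, map_smul, smul_eq_zero, or_iff_right hlc] at h0
  have h1 : (Φ T).1.1 (W v) + ((Φ (mkRankOne hA v p)).1.1 (W v)
      + (Φ (mkRankOne hA w q)).1.1 (W v)) = 0 := h0
  have h2 : T.1.1 v + ((rankOne v p).1 v + (rankOne w q).1 v) = 0 := hTv
  rw [eq_neg_of_add_eq_zero_left h1, eq_neg_of_add_eq_zero_left h2, hrank, hrank, ← smul_add,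
    ← map_add, map_neg, smul_neg]

theorem IsSplit.exists_form (hs : IsSplit hA Φ) (hΦ : PreservesOrthogonality Φ)
    (hA' : ∀ T ∈ A, star T ∈ A) (hD : ∀ x : D, ∃ y : D, y ≠ 0 ∧ inner ℂ x y = 0) :
    ∃ c : ℂ, c ≠ 0 ∧ ∃ U V : D → D,
      ((IsUnitaryOn U ∧ IsUnitaryOn V) ∨ (IsAntiunitaryOn U ∧ IsAntiunitaryOn V)) ∧
      ∀ (T : A) (x : D), (Φ T).1.1 x = c • U (T.1.1 (V x)) := by
  obtain ⟨f, g, hf, hg, hfg⟩ := hs.exists_factors hΦ hA' hD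
  obtain ⟨σ, hσ, hσf⟩ := exists_ringHom_map_smul hD hf.exists_map_smul hf.eq_zero hf.inner_eq_zero
  obtain ⟨τ, hτ, hτg⟩ := exists_ringHom_map_smul hD hg.exists_map_smul hg.eq_zero hg.inner_eq_zero
  -- `rankOne (c • x) y = rankOne x (conj c • y)`, so the two scalar actions coincide.
  have hστ : σ = τ := by
    obtain ⟨e, he, -⟩ := hD 0
    have hfe : f e ≠ 0 := fun h => he (hf.eq_zero e h)
    have hge : g e ≠ 0 := fun h => he (hg.eq_zero e h)
    ext1 c
    have h1 : mkRankOne hA (c • e) e = mkRankOne hA e (starRingEnd ℂ c • e) := Subtype.ext (by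
      change rankOne (c • e) e = rankOne e (starRingEnd ℂ c • e)
      rw [rankOne_smul_left, rankOne_smul_right, Complex.conj_conj])
    have h2 := congrArg (fun T => (Φ T).1) h1
    simp only [hfg, hσf, hτg] at h2
    have h3 : rankOne (σ c • f e) (g e)
        = rankOne (starRingEnd ℂ (τ (starRingEnd ℂ c)) • f e) (g e) :=
      h2.trans ((rankOne_smul_right _ _ _).trans (rankOne_smul_left _ _ _).symm)
    have h4 := smul_left_injective ℂ hfe (rankOne_left_injective hge h3)
    rw [h4]
    rcases hτ with rfl | rfl
    · exact Complex.conj_conj c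
    · exact congrArg _ (Complex.conj_conj c)
  subst hστ
  rcases hσ with rfl | rfl
  · obtain ⟨k, U, hk, hU, -⟩ := exists_isometryEquiv (fun _ => rfl) (fun _ => rfl) hD hσf
      hf.eq_zero hf.exists_mem_span hf.inner_eq_zero
    obtain ⟨l, W, hl, hW, hWi⟩ := exists_isometryEquiv (fun _ => rfl) (fun _ => rfl) hD hτg
      hg.eq_zero hg.exists_mem_span hg.inner_eq_zero
    exact ⟨((k * l : ℝ) : ℂ), by exact_mod_cast (mul_pos hk hl).ne', U, W.symm,
      Or.inl ⟨⟨U, fun _ => rfl⟩, ⟨W.symm, fun _ => rfl⟩⟩,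
      map_apply_of_factors hΦ hk hl hWi hU hW hfg⟩
  · obtain ⟨k, U, hk, hU, -⟩ := exists_isometryEquiv Complex.norm_conj Complex.conj_ofReal hD hσf
      hf.eq_zero hf.exists_mem_span hf.inner_eq_zero
    obtain ⟨l, W, hl, hW, hWi⟩ := exists_isometryEquiv Complex.norm_conj Complex.conj_ofReal hD hτg
      hg.eq_zero hg.exists_mem_span hg.inner_eq_zero
    exact ⟨((k * l : ℝ) : ℂ), by exact_mod_cast (mul_pos hk hl).ne', U, W.symm,
      Or.inr ⟨⟨U, fun _ => rfl⟩, ⟨W.symm, fun _ => rfl⟩⟩,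
      map_apply_of_factors hΦ hk hl hWi hU hW hfg⟩

theorem rankOne_mem_of_isStarIdeal {B : NonUnitalStarSubalgebra ℂ (LPlus D)} (hB : IsStarIdeal B)
    {T : LPlus D} (hT : T ∈ B) (hT0 : T ≠ 0) (x y : D) : rankOne x y ∈ B := by
  obtain ⟨z, hz⟩ : ∃ z, T.1 z ≠ 0 := by
    by_contra! h
    exact hT0 (ext_apply h)
  -- `rankOne x (T z) * T * rankOne z y = ‖T z‖² • rankOne x y`
  have h := (hB (rankOne z y) _ (hB (rankOne x (T.1 z)) T hT).1).2
  rw [mul_assoc, mul_rankOne, mul_rankOne, rankOne_apply, rankOne_smul_left] at h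
  have h' := B.toSubmodule.smul_mem (inner ℂ (T.1 z) (T.1 z))⁻¹ h
  rwa [smul_smul, inv_mul_cancel₀ (inner_self_ne_zero.2 hz), one_smul] at h'

theorem isUnitaryOn_id : IsUnitaryOn (id : D → D) :=
  ⟨LinearIsometryEquiv.refl ℂ D, fun _ => rfl⟩

end UnboundedOp

theorem theorem3p1 {H : Type*} [NormedAddCommGroup H] [InnerProductSpace ℂ H] [CompleteSpace H]
    (D : Submodule ℂ H) (hdense : Dense (D : Set H)) (hF : UnboundedOp.IsFDomain D)
    (hdim : Module.rank ℂ D ≠ 1)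
    (A : NonUnitalStarSubalgebra ℂ (UnboundedOp.LPlus D))
    (hA : (A : Set (UnboundedOp.LPlus D)) = UnboundedOp.finiteRank D ∨
      (UnboundedOp.IsStandard A ∧ 1 ∈ A) ∨
      (UnboundedOp.IsStarIdeal A ∧ (A : Set (UnboundedOp.LPlus D)) ≠ UnboundedOp.finiteRank D))
    (Φ : A → A) (hadd : ∀ S T : A, Φ (S + T) = Φ S + Φ T) (hbij : Function.Bijective Φ)
    (horth : ∀ S T : A, UnboundedOp.Orthogonal S.1 T.1 ↔
      UnboundedOp.Orthogonal (Φ S).1 (Φ T).1) :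
    (∃ c : ℂ, c ≠ 0 ∧ ∃ U V : D → D,
      ((UnboundedOp.IsUnitaryOn U ∧ UnboundedOp.IsUnitaryOn V) ∨
        (UnboundedOp.IsAntiunitaryOn U ∧ UnboundedOp.IsAntiunitaryOn V)) ∧
      ∀ (T : A) (x : D), (Φ T).1.1 x = c • U (T.1.1 (V x))) ∨
    (∃ c : ℂ, c ≠ 0 ∧ ∃ U V : D → D,
      ((UnboundedOp.IsUnitaryOn U ∧ UnboundedOp.IsUnitaryOn V) ∨
        (UnboundedOp.IsAntiunitaryOn U ∧ UnboundedOp.IsAntiunitaryOn V)) ∧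
      ∀ (T : A) (x : D), (Φ T).1.1 x = c • U ((star T.1).1 (V x))) := by
  open UnboundedOp in
  -- The zero ideal is a legitimate choice of `A`; it is the only one without rank one operators.
  by_cases hzero : ∀ T ∈ A, T = 0
  · refine Or.inl ⟨1, one_ne_zero, id, id, Or.inl ⟨isUnitaryOn_id, isUnitaryOn_id⟩, fun T x => ?_⟩
    rw [hzero _ T.2, hzero _ (Φ T).2, one_smul]
    rfl
  push Not at hzero
  obtain ⟨T, hT, hT0⟩ := hzero
  have hmem : ∀ x y : D, rankOne x y ∈ A := by
    intro x y
    rcases hA with h | ⟨h, -⟩ | ⟨h, -⟩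
    · rw [← SetLike.mem_coe, h]
      exact rankOne_mem_finiteRank x y
    · exact h (rankOne_mem_finiteRank x y)
    · exact rankOne_mem_of_isStarIdeal h hT hT0 x y
  have : Nontrivial D := by
    by_contra hD
    rw [not_nontrivial_iff_subsingleton] at hD
    exact hT0 (ext_apply fun z => Subsingleton.elim _ _)
  have hD := fun x : D => exists_ne_zero_inner_eq_zero hdim x
  let B : Submodule ℂ (LPlus D) := A.toNonUnitalSubalgebra.toSubmodule
  have hB : ∀ T ∈ B, star T ∈ B := fun T hT => A.star_mem' hT
  have hmemB : ∀ x y : D, rankOne x y ∈ B := hmem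
  let Ψ : B ≃+ B := { Equiv.ofBijective Φ hbij with map_add' := hadd }
  have hΨ : PreservesOrthogonality Ψ := horth
  rcases hΨ.isSplit_or_isSplit (hA := hmemB) hB hD with hs | hs
  · exact Or.inl (hs.exists_form hΨ hB hD)
  · obtain ⟨c, hc, U, V, hUV, h⟩ := hs.exists_form (hΨ.starEquiv_trans hB) hB hD
    refine Or.inr ⟨c, hc, U, V, hUV, fun T x => ?_⟩
    have hT := h (starEquiv hB T) x
    rw [AddEquiv.trans_apply] at hT
    have hTT : starEquiv hB (starEquiv hB T) = T := Subtype.ext (star_star T.1)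
    rw [hTT] at hT
    exact hT
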